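/- Let $(R,\mathfrak m,k)$ be either (a) a noetherian local ring with maximal ideal $\mathfrak m$ and residue field $k$, or (b) a standard graded algebra over a field $k$ (that is, $R=\bigoplus_{i\ge 0}R_i$ is commutative, $R_0=k$, and $R$ is generated as a $k$-algebra by the finite-dimensional space $R_1$) with graded maximal ideal $\mathfrak m=\bigoplus_{i\ge1}R_i$. In case (b) all modules are $\mathbb Z$-graded, all maps between them are homogeneous of degree $0$, and all resolutions are graded. For a finitely generated $R$-module $M$ with minimal free resolution $F$ (so $\partial(F_i)\subseteq\mathfrak mF_{i-1}$ for all $i\ge 1$), filter $F$ by the subcomplexes $\mathcal G^nF$ with $(\mathcal G^nF)_i=\mathfrak m^{\,n-i}F_i$, where $\mathfrak m^j=R$ for $j\le 0$. Let $\operatorname{lin}^RF$ be the associated graded complex, and put $\operatorname{lind}_RM=\sup\{i: H_i(\operatorname{lin}^RF)\ne 0\}\in\{0,1,2,\dots,\infty\}$, with $\operatorname{lind}_R0=0$. The module $M$ is called Koszul if $\operatorname{lind}_RM=0$. **Theorem 3.5.** Let $0\to M\xrightarrow{\varphi} P\xrightarrow{\lambda} N\to 0$ be a short exact sequence of non-zero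 finitely generated $R$-modules such that $P$ is a Koszul module and $M\subseteq\mathfrak mP$ (where $M$ is identified with $\varphi(M)$). Then $$\operatorname{lind}_RN-1\le\operatorname{lind}_RM\le\max\{0,\operatorname{lind}_RN-1\}.$$ In particular, $\operatorname{lind}_RN=\operatorname{lind}_RM+1$ if $\operatorname{lind}_RM\ge 1$, and $\operatorname{lind}_RN\le 1$ if $\operatorname{lind}_RM=0$. Furthermore, $\operatorname{lind}_RN=0$ if and only if $M$ is a Koszul module and $M\cap\mathfrak m^{s+1}P=\mathfrak m^sM$ for all $s\ge 0$. -/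

import Mathlib

noncomputable section

/-- A minimal free resolution of the `R`-module `M` with respect to the ideal `m`:
free modules `F i = R ^ (rank i)` of finite rank, differentials `d i : F (i + 1) → F i` and an
augmentation `ε : F 0 → M` such that `⋯ → F 1 → F 0 → M → 0` is exact and
`d (F (i + 1)) ⊆ m F i` for all `i`. -/
structure MinimalFreeResolution {R : Type*} [CommRing R] (m : Ideal R)
    (M : Type*) [AddCommGroup M] [Module R M] where
  rank : ℕ → ℕ
  d : ∀ i, (Fin (rank (i + 1)) → R) →ₗ[R] (Fin (rank i) → R)
  ε : (Fin (rank 0) → R) →ₗ[R] M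
  ε_surjective : Function.Surjective ε
  exact_zero : Function.Exact (d 0) ε
  exact_succ : ∀ i, Function.Exact (d (i + 1)) (d i)
  minimal : ∀ i, LinearMap.range (d i) ≤ m • (⊤ : Submodule R (Fin (rank i) → R))

namespace MinimalFreeResolution

section LinearPart

variable {R : Type*} [CommRing R] {m : Ideal R} {M : Type*} [AddCommGroup M] [Module R M]
  (F : MinimalFreeResolution m M)

/-- The filtration `(𝒢ⁿ F)_i = m ^ (n - i) F_i`, where `m ^ j = R` for `j ≤ 0`: the truncated
subtraction of natural numbers is exactly this convention. -/
def filt (n i : ℕ) : Submodule R (Fin (F.rank i) → R) :=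
  m ^ (n - i) • (⊤ : Submodule R (Fin (F.rank i) → R))

theorem d_mem_filt (n i : ℕ) : ∀ x ∈ F.filt n (i + 1), F.d i x ∈ F.filt n i := by
  intro x hx
  have h1 : F.d i x ∈ (F.filt n (i + 1)).map (F.d i) := Submodule.mem_map_of_mem hx
  have h2 : (F.filt n (i + 1)).map (F.d i)
      ≤ m ^ (n - (i + 1)) • (m • (⊤ : Submodule R (Fin (F.rank i) → R))) := by
    rw [filt, Submodule.map_smul'', Submodule.map_top]
    exact Submodule.smul_mono le_rfl (F.minimal i)
  have h3 : m ^ (n - (i + 1)) • (m • (⊤ : Submodule R (Fin (F.rank i) → R))) ≤ F.filt n i := by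
    rw [← Submodule.mul_smul, ← pow_succ, filt]
    exact Submodule.smul_mono (Ideal.pow_le_pow_right (by omega)) le_rfl
  exact h3 (h2 h1)

/-- The linear part of `F` is the associated graded complex of `F` for the filtration `𝒢ⁿ F`. It is
the direct sum over `n` of its graded strands; this is the term `(𝒢ⁿ F)_i / (𝒢ⁿ⁺¹ F)_i` in
homological degree `i` of the `n`-th strand. -/
abbrev lin (n i : ℕ) : Type _ := F.filt n i ⧸ (F.filt (n + 1) i).submoduleOf (F.filt n i)

/-- The differential of the linear part: the map
`(𝒢ⁿ F)_{i+1} / (𝒢ⁿ⁺¹ F)_{i+1} → (𝒢ⁿ F)_i / (𝒢ⁿ⁺¹ F)_i` induced by the differential of `F`. -/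
def linD (n i : ℕ) : F.lin n (i + 1) →ₗ[R] F.lin n i :=
  Submodule.mapQ _ _ ((F.d i).restrict (F.d_mem_filt n i))
    (fun x hx => F.d_mem_filt (n + 1) i x.1 hx)

/-- The cycles of the linear part (the differential out of degree `0` is zero). -/
def linCycles (n : ℕ) : ∀ i, Submodule R (F.lin n i)
  | 0 => ⊤
  | i + 1 => LinearMap.ker (F.linD n i)

theorem range_linD_le_linCycles (n i : ℕ) :
    LinearMap.range (F.linD n i) ≤ F.linCycles n i := by
  cases i with
  | zero => exact le_top
  | succ i =>
    rintro _ ⟨y, rfl⟩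
    obtain ⟨z, rfl⟩ := Submodule.Quotient.mk_surjective _ y
    refine (Submodule.Quotient.mk_eq_zero _).2 ?_
    have h0 : F.d i (F.d (i + 1) z.1) = 0 := (F.exact_succ i).apply_apply_eq_zero z.1
    change F.d i (F.d (i + 1) z.1) ∈ F.filt (n + 1) i
    rw [h0]
    exact Submodule.zero_mem _

/-- The `n`-th graded component of `H_i` of the linear part of `F`. -/
abbrev linHomology (n i : ℕ) : Type _ :=
  F.linCycles n i ⧸ (LinearMap.range (F.linD n i)).submoduleOf (F.linCycles n i)

/-- `sup {i : H_i (lin F) ≠ 0}`, with value `0` if there is no such `i`. The homology `H_i` is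
nonzero if and only if one of its graded components is. -/
def linearityDefect : ℕ∞ :=
  sSup {t : ℕ∞ | ∃ i : ℕ, t = (i : ℕ∞) ∧ ∃ n : ℕ, Nontrivial (F.linHomology n i)}

end LinearPart

end MinimalFreeResolution

/-- The linearity defect of a module over a local ring. All minimal free resolutions of `M` are
isomorphic, so the supremum over `F` is over equal numbers. It is `0` for `M = 0`. -/
def lind (R : Type*) [CommRing R] [IsLocalRing R] (M : Type*) [AddCommGroup M] [Module R M] :
    ℕ∞ :=
  ⨆ F : MinimalFreeResolution (IsLocalRing.maximalIdeal R) M, F.linearityDefect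

/-- Koszul modules over a local ring. -/
def IsKoszulModule (R : Type*) [CommRing R] [IsLocalRing R]
    (M : Type*) [AddCommGroup M] [Module R M] : Prop :=
  lind R M = 0

/-- Standard graded `k`-algebras: `R₀ = k`, and `R` is generated as a `k`-algebra by `R₁`, which
is finite-dimensional. -/
structure IsStandardGraded {k R : Type*} [Field k] [CommRing R] [Algebra k R]
    (𝒜 : ℕ → Submodule k R) [GradedAlgebra 𝒜] : Prop where
  nontrivial : Nontrivial R
  degree_zero : ∀ x ∈ 𝒜 0, ∃ c : k, algebraMap k R c = x
  finite_one : Module.Finite k (𝒜 1)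
  adjoin_one : Algebra.adjoin k (𝒜 1 : Set R) = ⊤

section Graded

variable {k R : Type*} [Field k] [CommRing R] [Algebra k R] (𝒜 : ℕ → Submodule k R)

/-- `ℳ` makes `M` a `ℤ`-graded module over the `ℕ`-graded ring `R`. -/
structure IsGradedModule {M : Type*} [AddCommGroup M] [Module R M] (ℳ : ℤ → AddSubgroup M) :
    Prop where
  isInternal : DirectSum.IsInternal ℳ
  smul_mem : ∀ (i : ℕ) (j : ℤ) (a : R) (x : M), a ∈ 𝒜 i → x ∈ ℳ j → a • x ∈ ℳ (i + j)

/-- `f` is homogeneous of degree `0`. -/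
def IsGradedMap {M N : Type*} [AddCommGroup M] [Module R M] [AddCommGroup N] [Module R N]
    (ℳ : ℤ → AddSubgroup M) (𝒩 : ℤ → AddSubgroup N) (f : M →ₗ[R] N) : Prop :=
  ∀ (i : ℤ) (x : M), x ∈ ℳ i → f x ∈ 𝒩 i

/-- The graded pieces of the graded free module `⨁ j, R(-a j)`, whose `j`-th basis vector has
degree `a j`: its elements of degree `n` are the vectors whose `j`-th entry is homogeneous of
degree `n - a j` (and zero if `n < a j`). -/
def freeGrading {b : ℕ} (a : Fin b → ℤ) (n : ℤ) : AddSubgroup (Fin b → R) where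
  carrier := {x | ∀ j, (a j ≤ n → x j ∈ 𝒜 (n - a j).toNat) ∧ (n < a j → x j = 0)}
  zero_mem' := fun _ => ⟨fun _ => zero_mem _, fun _ => rfl⟩
  add_mem' := fun hx hy j =>
    ⟨fun h => add_mem ((hx j).1 h) ((hy j).1 h), fun h => by simp [(hx j).2 h, (hy j).2 h]⟩
  neg_mem' := fun hx j => ⟨fun h => neg_mem ((hx j).1 h), fun h => by simp [(hx j).2 h]⟩

/-- A minimal free resolution of `M` is a minimal graded free resolution if degrees can be given
to the basis vectors such that the differentials and the augmentation are homogeneous of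
degree `0`. -/
def MinimalFreeResolution.IsGraded {m : Ideal R} {M : Type*} [AddCommGroup M] [Module R M]
    (F : MinimalFreeResolution m M) (ℳ : ℤ → AddSubgroup M) : Prop :=
  ∃ a : ∀ i, Fin (F.rank i) → ℤ,
    (∀ i, IsGradedMap (freeGrading 𝒜 (a (i + 1))) (freeGrading 𝒜 (a i)) (F.d i)) ∧
    IsGradedMap (freeGrading 𝒜 (a 0)) ℳ F.ε

/-- The linearity defect of a graded module over a standard graded algebra, computed from minimal
graded free resolutions (which are all isomorphic) with respect to the graded maximal ideal. -/
def gradedLind [GradedAlgebra 𝒜] {M : Type*} [AddCommGroup M] [Module R M]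
    (ℳ : ℤ → AddSubgroup M) : ℕ∞ :=
  ⨆ (F : MinimalFreeResolution (HomogeneousIdeal.irrelevant 𝒜).toIdeal M)
    (_ : F.IsGraded 𝒜 ℳ), F.linearityDefect

/-- Koszul modules over a standard graded algebra. -/
def IsGradedKoszulModule [GradedAlgebra 𝒜] {M : Type*} [AddCommGroup M] [Module R M]
    (ℳ : ℤ → AddSubgroup M) : Prop :=
  gradedLind 𝒜 ℳ = 0

end Graded

end

/-! ### Powers of an ideal acting on modules. -/

noncomputable section

/-! Let `F` and `G` be minimal resolutions of `M` and `P`. Since `P` is Koszul and `M ⊆ mP`, the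
inclusion lifts to a chain map `f : F → G` with `f(F) ⊆ mG` (`exists_chainMap_mem`), so its mapping
cone is a minimal resolution of `N` (`cone`). Such an `f` raises the filtration by one, and the
linear part of the cone is an extension of the shifted `lin F` by `lin G`. As `lin G` is acyclic in
positive degrees, `H_{i+1}` of this extension is `H_i(lin F)` for `i ≥ 1`
(`ConeEquiv.linExact_succ`); this gives the inequalities.

If `M` is Koszul too, `H_1` of the extension is the kernel of the map `gr M → gr P` of degree one
induced by `φ` (`ConeEquiv.linExact_zero`). Its injectivity amounts to the equalities `M ∩ m^(s+1) P
= m^s M` (`inf_pow_smul_eq_map_iff`).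

The argument works for any ideal `m`. The local and graded settings provide the minimal resolutions;
the choice of resolution is immaterial by `linearityDefect_eq`. -/

theorem Submodule.map_mem_pow_succ_smul_top {R A B : Type*} [CommRing R] [AddCommGroup A]
    [Module R A] [AddCommGroup B] [Module R B] {m : Ideal R} {f : A →ₗ[R] B}
    (hf : ∀ x, f x ∈ m • (⊤ : Submodule R B)) {k : ℕ} {x : A}
    (hx : x ∈ m ^ k • (⊤ : Submodule R A)) : f x ∈ m ^ (k + 1) • (⊤ : Submodule R B) := by
  have h1 : f x ∈ (m ^ k • (⊤ : Submodule R A)).map f := Submodule.mem_map_of_mem hx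
  rw [Submodule.map_smul''] at h1
  rw [pow_succ, Submodule.mul_smul]
  refine Submodule.smul_mono le_rfl ?_ h1
  rintro _ ⟨y, -, rfl⟩
  exact hf y

theorem Submodule.map_mem_smul_top {R A B : Type*} [CommRing R] [AddCommGroup A]
    [Module R A] [AddCommGroup B] [Module R B] {I : Ideal R} (f : A →ₗ[R] B) {x : A}
    (hx : x ∈ I • (⊤ : Submodule R A)) : f x ∈ I • (⊤ : Submodule R B) := by
  have h1 : f x ∈ (I • (⊤ : Submodule R A)).map f := Submodule.mem_map_of_mem hx
  rw [Submodule.map_smul''] at h1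
  exact Submodule.smul_mono le_rfl le_top h1

theorem Submodule.exists_mem_smul_top_of_surjective {R A B : Type*} [CommRing R] [AddCommGroup A]
    [Module R A] [AddCommGroup B] [Module R B] {I : Ideal R} {f : A →ₗ[R] B}
    (hf : Function.Surjective f) {y : B} (hy : y ∈ I • (⊤ : Submodule R B)) :
    ∃ x ∈ I • (⊤ : Submodule R A), f x = y := by
  have : (I • (⊤ : Submodule R A)).map f = I • ⊤ := by
    rw [Submodule.map_smul'', Submodule.map_top, LinearMap.range_eq_top.2 hf]
  rw [← this] at hy
  exact hy

theorem Submodule.pow_smul_top_antitone {R A : Type*} [CommRing R] [AddCommGroup A] [Module R A]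
    {m : Ideal R} {k l : ℕ} (h : k ≤ l) :
    (m ^ l • ⊤ : Submodule R A) ≤ m ^ k • ⊤ :=
  Submodule.smul_mono (Ideal.pow_le_pow_right h) le_rfl

/-- Linear maps out of a free module lift, with values in a prescribed submodule. -/
theorem LinearMap.exists_lift_of_free {R A B : Type*} [CommRing R] [AddCommGroup A]
    [Module R A] [AddCommGroup B] [Module R B] {b : ℕ} (g : (Fin b → R) →ₗ[R] A) (d : B →ₗ[R] A)
    (S : Submodule R B) (h : ∀ x, ∃ y ∈ S, d y = g x) :
    ∃ l : (Fin b → R) →ₗ[R] B, (∀ x, d (l x) = g x) ∧ ∀ x, l x ∈ S := by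
  choose y hyS hy using fun x => h x
  let e := Pi.basisFun R (Fin b)
  refine ⟨S.subtype ∘ₗ e.constr R (fun j => (⟨y (e j), hyS _⟩ : S)), fun x => ?_,
    fun x => Subtype.property _⟩
  have : d ∘ₗ S.subtype ∘ₗ e.constr R (fun j => (⟨y (e j), hyS _⟩ : S)) = g :=
    e.ext fun j => by
      rw [LinearMap.comp_apply, LinearMap.comp_apply, Module.Basis.constr_basis]
      exact hy _
  exact LinearMap.congr_fun this x

/-! ### Exactness of the linear part and independence of the resolution. -/

namespace MinimalFreeResolution

variable {R : Type*} [CommRing R] {m : Ideal R} {M : Type*} [AddCommGroup M] [Module R M]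
  (F : MinimalFreeResolution m M)

theorem d_d (i : ℕ) (x : Fin (F.rank (i + 2)) → R) : F.d i (F.d (i + 1) x) = 0 :=
  (F.exact_succ i).apply_apply_eq_zero x

theorem ε_d (x : Fin (F.rank 1) → R) : F.ε (F.d 0 x) = 0 :=
  F.exact_zero.apply_apply_eq_zero x

theorem d_mem (i : ℕ) (x : Fin (F.rank (i + 1)) → R) :
    F.d i x ∈ m • (⊤ : Submodule R (Fin (F.rank i) → R)) :=
  F.minimal i ⟨x, rfl⟩

theorem filt_antitone {n n' : ℕ} (h : n ≤ n') (i : ℕ) : F.filt n' i ≤ F.filt n i :=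
  Submodule.pow_smul_top_antitone (by omega)

theorem filt_eq_top {n i : ℕ} (h : n ≤ i) : F.filt n i = ⊤ := by
  rw [filt, Nat.sub_eq_zero_of_le h, pow_zero, Ideal.one_eq_top, Submodule.top_smul]

/-- Exactness of the `n`-th strand of the linear part in homological degree `i + 1`. -/
def LinExact (n i : ℕ) : Prop :=
  ∀ x ∈ F.filt n (i + 1), F.d i x ∈ F.filt (n + 1) i →
    ∃ y ∈ F.filt n (i + 2), x - F.d (i + 1) y ∈ F.filt (n + 1) (i + 1)

/-- Here the exponent in `F.filt (n + 1) (i + 1)` truncates to `0`, so this term of the strand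
vanishes. -/
theorem linExact_of_le {n i : ℕ} (h : n ≤ i) : F.LinExact n i := fun x _ _ =>
  ⟨0, zero_mem _, by rw [F.filt_eq_top (by omega)]; trivial⟩

theorem subsingleton_linHomology_succ_iff (n i : ℕ) :
    Subsingleton (F.linHomology n (i + 1)) ↔ F.LinExact n i := by
  rw [Submodule.Quotient.subsingleton_iff, Submodule.submoduleOf_eq_top]
  constructor
  · intro h x hx hdx
    have h1 : (Submodule.Quotient.mk ⟨x, hx⟩ : F.lin n (i + 1)) ∈ F.linCycles n (i + 1) :=
      (Submodule.Quotient.mk_eq_zero _).2 hdx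
    obtain ⟨y, hy⟩ := h h1
    obtain ⟨z, rfl⟩ := Submodule.Quotient.mk_surjective _ y
    refine ⟨z.1, z.2, ?_⟩
    exact (Submodule.Quotient.eq
      ((F.filt (n + 1) (i + 1)).submoduleOf (F.filt n (i + 1)))).1 hy.symm
  · intro h x hx
    obtain ⟨z, rfl⟩ := Submodule.Quotient.mk_surjective _ x
    have h1 : F.d i z.1 ∈ F.filt (n + 1) i := 
      (Submodule.Quotient.mk_eq_zero ((F.filt (n + 1) i).submoduleOf (F.filt n i))).1 hx
    obtain ⟨y, hy, hxy⟩ := h z.1 z.2 h1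
    refine ⟨Submodule.Quotient.mk ⟨y, hy⟩, ?_⟩
    exact ((Submodule.Quotient.eq
      ((F.filt (n + 1) (i + 1)).submoduleOf (F.filt n (i + 1)))).2 hxy).symm

theorem linearityDefect_le_iff (t : ℕ) :
    F.linearityDefect ≤ t ↔ ∀ i, t ≤ i → ∀ n, F.LinExact n i := by
  rw [linearityDefect, sSup_le_iff]
  constructor
  · intro h i hi n
    rw [← subsingleton_linHomology_succ_iff]
    by_contra hc
    have h1 := h _ ⟨i + 1, rfl, n, not_subsingleton_iff_nontrivial.1 hc⟩
    have h2 : i + 1 ≤ t := by exact_mod_cast h1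
    omega
  · rintro h _ ⟨i, rfl, n, hn⟩
    rcases i with _ | i
    · simp
    · by_contra hc
      have h2 : t ≤ i := by
        have : ¬ (i + 1 ≤ t) := fun h => hc (by exact_mod_cast h)
        omega
      exact not_subsingleton_iff_nontrivial.2 hn
        ((F.subsingleton_linHomology_succ_iff n i).2 (h i h2 n))

theorem linearityDefect_eq_zero_iff :
    F.linearityDefect = 0 ↔ ∀ i n, F.LinExact n i := by
  rw [← nonpos_iff_eq_zero, ← Nat.cast_zero, linearityDefect_le_iff]
  simp

variable {F}

/-- Comparison of resolutions along a map `φ`, with values in prescribed submodules. -/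
theorem exists_chainMap {P : Type*} [AddCommGroup P] [Module R P]
    (F : MinimalFreeResolution m M) (G : MinimalFreeResolution m P) (φ : M →ₗ[R] P)
    (S : ∀ i, Submodule R (Fin (G.rank i) → R))
    (h0 : ∀ x, ∃ y ∈ S 0, G.ε y = φ x)
    (h : ∀ i, ∀ x ∈ m • S i, x ∈ LinearMap.range (G.d i) → ∃ y ∈ S (i + 1), G.d i y = x) :
    ∃ f : ∀ i, (Fin (F.rank i) → R) →ₗ[R] (Fin (G.rank i) → R),
      (∀ x, G.ε (f 0 x) = φ (F.ε x)) ∧ (∀ i x, G.d i (f (i + 1) x) = f i (F.d i x)) ∧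
      ∀ i x, f i x ∈ S i := by
  -- The recursion must remember that `f ∘ d` lands in the boundaries of `G`, for otherwise the next
  -- lift need not exist.
  let T : ℕ → Type _ := fun i => {f : (Fin (F.rank i) → R) →ₗ[R] (Fin (G.rank i) → R) //
    (∀ x, f x ∈ S i) ∧ ∀ x, f (F.d i x) ∈ LinearMap.range (G.d i)}
  have start : ∃ f : T 0, ∀ x, G.ε (f.1 x) = φ (F.ε x) := by
    obtain ⟨l, hl, hS⟩ := LinearMap.exists_lift_of_free (φ ∘ₗ F.ε) G.ε (S 0) (fun x => h0 _)
    refine ⟨⟨l, hS, fun x => ?_⟩, hl⟩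
    refine (G.exact_zero _).1 ?_
    rw [hl, LinearMap.comp_apply, F.ε_d, map_zero]
  have step : ∀ i (f : T i), ∃ g : T (i + 1), ∀ x, G.d i (g.1 x) = f.1 (F.d i x) := by
    rintro i ⟨f, hfS, hf⟩
    -- Minimality of `F` supplies the factor `m`; this is why `h` is only assumed on `m • S i`.
    have hm : ∀ x, f (F.d i x) ∈ m • S i := fun x => by
      have h1 : f (F.d i x) ∈ (m • (⊤ : Submodule R _)).map f :=
        Submodule.mem_map_of_mem (F.d_mem i x)
      rw [Submodule.map_smul''] at h1
      refine Submodule.smul_mono le_rfl ?_ h1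
      rintro _ ⟨y, -, rfl⟩
      exact hfS y
    obtain ⟨l, hl, hS⟩ := LinearMap.exists_lift_of_free (f ∘ₗ F.d i) (G.d i) (S (i + 1))
      (fun x => h i _ (hm x) (hf x))
    refine ⟨⟨l, hS, fun x => ?_⟩, hl⟩
    refine (G.exact_succ i _).1 ?_
    rw [hl, LinearMap.comp_apply, F.d_d, map_zero]
  obtain ⟨f0, hf0⟩ := start
  choose s hs using step
  let f : ∀ i, T i := fun i => Nat.rec f0 s i
  exact ⟨fun i => (f i).1, hf0, fun i x => hs i (f i) x, fun i x => (f i).2.1 x⟩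

/-- A chain endomorphism of a minimal resolution over the zero map is zero modulo `m`. -/
theorem chainMap_mem_of_zero (c : ∀ i, (Fin (F.rank i) → R) →ₗ[R] (Fin (F.rank i) → R))
    (h0 : ∀ x, F.ε (c 0 x) = 0) (hc : ∀ i x, F.d i (c (i + 1) x) = c i (F.d i x)) (i : ℕ) :
    ∀ x, c i x ∈ m • (⊤ : Submodule R (Fin (F.rank i) → R)) := by
  -- The induction carries a homotopy `h` through `d h d = c d`, exactly what makes `c - h d`
  -- cycle-valued in the next degree. Then `c = d h + h d` has values in `m F`.
  suffices H : ∃ h : (Fin (F.rank i) → R) →ₗ[R] (Fin (F.rank (i + 1)) → R),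
      (∀ x, F.d i (h (F.d i x)) = c i (F.d i x)) ∧
      ∀ x, c i x ∈ m • (⊤ : Submodule R (Fin (F.rank i) → R)) from H.choose_spec.2
  induction i with
  | zero =>
    obtain ⟨l, hl, -⟩ := LinearMap.exists_lift_of_free (c 0) (F.d 0) ⊤ (fun x => by
      obtain ⟨y, hy⟩ := (F.exact_zero _).1 (h0 x)
      exact ⟨y, trivial, hy⟩)
    exact ⟨l, fun x => hl _, fun x => hl x ▸ F.d_mem 0 _⟩
  | succ i ih =>
    obtain ⟨h, h1, -⟩ := ih
    obtain ⟨l, hl, -⟩ := LinearMap.exists_lift_of_free (c (i + 1) - h ∘ₗ F.d i) (F.d (i + 1)) ⊤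
      (fun x => by
        obtain ⟨y, hy⟩ := (F.exact_succ i ((c (i + 1) - h ∘ₗ F.d i) x)).1 (by
          simp [map_sub, h1, hc])
        exact ⟨y, trivial, hy⟩)
    refine ⟨l, fun x => ?_, fun x => ?_⟩
    · simp [hl, F.d_d]
    · have : c (i + 1) x = F.d (i + 1) (l x) + h (F.d i x) := by simp [hl]
      rw [this]
      exact add_mem (F.d_mem _ _) (Submodule.map_mem_smul_top h (F.d_mem i x))

/-- For comparison maps `a`, `b`, the endomorphism `id - a b` lifts zero, hence has values in `m G`
and vanishes on the associated graded complex. So a cycle can be moved by `b`, bounded in `F`, and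
moved back by `a`. -/
theorem LinExact.of_resolution {G : MinimalFreeResolution m M} {n i : ℕ} (h : F.LinExact n i) :
    G.LinExact n i := by
  have key : ∀ F G : MinimalFreeResolution m M,
      ∃ f : ∀ i, (Fin (F.rank i) → R) →ₗ[R] (Fin (G.rank i) → R),
        (∀ x, G.ε (f 0 x) = F.ε x) ∧ ∀ i x, G.d i (f (i + 1) x) = f i (F.d i x) := by
    intro F G
    obtain ⟨f, h0, h1, -⟩ := exists_chainMap F G LinearMap.id (fun _ => ⊤)
      (fun x => by obtain ⟨y, hy⟩ := G.ε_surjective x; exact ⟨y, trivial, hy⟩)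
      (fun i x _ ⟨y, hy⟩ => ⟨y, trivial, hy⟩)
    exact ⟨f, h0, h1⟩
  obtain ⟨a, a0, ad⟩ := key F G
  obtain ⟨b, b0, bd⟩ := key G F
  have hc := chainMap_mem_of_zero (F := G) (fun i => LinearMap.id - a i ∘ₗ b i)
    (by simp [a0, b0]) (by simp [ad, bd])
  intro x hx hdx
  obtain ⟨y, hy, hxy⟩ := h (b _ x) (Submodule.map_mem_smul_top (b _) hx)
    (by rw [bd]; exact Submodule.map_mem_smul_top (b _) hdx)
  refine ⟨a _ y, Submodule.map_mem_smul_top (a _) hy, ?_⟩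
  have h1 : a (i + 1) (b _ x - F.d (i + 1) y) ∈ G.filt (n + 1) (i + 1) :=
    Submodule.map_mem_smul_top (a _) hxy
  have h2 : x - a (i + 1) (b (i + 1) x) ∈ G.filt (n + 1) (i + 1) :=
    Submodule.pow_smul_top_antitone (by omega : n + 1 - (i + 1) ≤ n - (i + 1) + 1)
      (Submodule.map_mem_pow_succ_smul_top (hc (i + 1)) hx)
  have h3 := add_mem h1 h2
  rw [ad]
  simpa using h3

theorem linearityDefect_eq (F G : MinimalFreeResolution m M) :
    F.linearityDefect = G.linearityDefect := by
  refine eq_of_forall_ge_iff fun t => ?_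
  induction t using ENat.recTopCoe with
  | top => simp
  | coe t =>
    simp only [linearityDefect_le_iff]
    exact ⟨fun h i hi n => (h i hi n).of_resolution, fun h i hi n => (h i hi n).of_resolution⟩

end MinimalFreeResolution

/-! ### Mapping cones as minimal resolutions. -/

/-- Splitting a vector of length `a + b`. -/
def finAddSplit (R : Type*) [CommRing R] (a b : ℕ) :
    (Fin (a + b) → R) ≃ₗ[R] (Fin a → R) × (Fin b → R) :=
  (LinearEquiv.funCongrLeft R R finSumFinEquiv).trans
    (LinearEquiv.sumArrowLequivProdArrow (Fin a) (Fin b) R R)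

theorem LinearEquiv.mem_smul_top_iff_prod {R A B C : Type*} [CommRing R] [AddCommGroup A]
    [Module R A] [AddCommGroup B] [Module R B] [AddCommGroup C] [Module R C]
    (e : A ≃ₗ[R] B × C) {I : Ideal R} {w : A} :
    w ∈ I • (⊤ : Submodule R A) ↔
      (e w).1 ∈ I • (⊤ : Submodule R B) ∧ (e w).2 ∈ I • (⊤ : Submodule R C) := by
  constructor
  · intro h
    exact ⟨Submodule.map_mem_smul_top (LinearMap.fst R _ _ ∘ₗ e.toLinearMap) h,
      Submodule.map_mem_smul_top (LinearMap.snd R _ _ ∘ₗ e.toLinearMap) h⟩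
  · rintro ⟨h1, h2⟩
    have h3 := add_mem
      (Submodule.map_mem_smul_top (e.symm.toLinearMap ∘ₗ LinearMap.inl R _ _) h1)
      (Submodule.map_mem_smul_top (e.symm.toLinearMap ∘ₗ LinearMap.inr R _ _) h2)
    rw [LinearMap.comp_apply, LinearMap.comp_apply, ← map_add] at h3
    simpa using h3

theorem LinearEquiv.mem_smul_top_iff {R A B : Type*} [CommRing R] [AddCommGroup A]
    [Module R A] [AddCommGroup B] [Module R B] (e : A ≃ₗ[R] B) {I : Ideal R} {w : A} :
    w ∈ I • (⊤ : Submodule R A) ↔ e w ∈ I • (⊤ : Submodule R B) :=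
  ⟨Submodule.map_mem_smul_top e.toLinearMap, fun h => by
    simpa using Submodule.map_mem_smul_top e.symm.toLinearMap h⟩

theorem LinearEquiv.forall_prod {R A B C : Type*} [CommRing R] [AddCommGroup A]
    [Module R A] [AddCommGroup B] [Module R B] [AddCommGroup C] [Module R C]
    (e : A ≃ₗ[R] B × C) {p : A → Prop} : (∀ w, p w) ↔ ∀ y z, p (e.symm (y, z)) :=
  ⟨fun h _ _ => h _, fun h w => by simpa using h (e w).1 (e w).2⟩

namespace MinimalFreeResolution

/-- The ranks of the free modules in a mapping cone. -/
def coneRank (p q : ℕ → ℕ) : ℕ → ℕ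
  | 0 => p 0
  | i + 1 => p (i + 1) + q i

/-- The free module in degree `0` of a mapping cone. -/
def coneZeroEquiv (R : Type*) [CommRing R] (p q : ℕ → ℕ) :
    (Fin (coneRank p q 0) → R) ≃ₗ[R] (Fin (p 0) → R) :=
  LinearEquiv.refl R (Fin (p 0) → R)

/-- The free module in degree `i + 1` of a mapping cone. -/
def coneSuccEquiv (R : Type*) [CommRing R] (p q : ℕ → ℕ) (i : ℕ) :
    (Fin (coneRank p q (i + 1)) → R) ≃ₗ[R] (Fin (p (i + 1)) → R) × (Fin (q i) → R) :=
  finAddSplit R (p (i + 1)) (q i)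

variable {R : Type*} [CommRing R] {m : Ideal R} {M P N : Type*} [AddCommGroup M] [Module R M]
  [AddCommGroup P] [Module R P] [AddCommGroup N] [Module R N]
  (F : MinimalFreeResolution m M) (G : MinimalFreeResolution m P)
  (φ : M →ₗ[R] P) (lam : P →ₗ[R] N)
  (f : ∀ i, (Fin (F.rank i) → R) →ₗ[R] (Fin (G.rank i) → R))

/-- The differential of a mapping cone. -/
def coneD : ∀ i, (Fin (coneRank G.rank F.rank (i + 1)) → R) →ₗ[R]
    (Fin (coneRank G.rank F.rank i) → R)
  | 0 => (coneZeroEquiv R G.rank F.rank).symm.toLinearMap ∘ₗ LinearMap.coprod (G.d 0) (f 0) ∘ₗ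
      (coneSuccEquiv R G.rank F.rank 0).toLinearMap
  | i + 1 => (coneSuccEquiv R G.rank F.rank i).symm.toLinearMap ∘ₗ
      (LinearMap.coprod (G.d (i + 1)) (f (i + 1))).prod (-(F.d i ∘ₗ LinearMap.snd R _ _)) ∘ₗ
        (coneSuccEquiv R G.rank F.rank (i + 1)).toLinearMap

theorem coneD_zero_symm (y : Fin (G.rank 1) → R) (z : Fin (F.rank 0) → R) :
    coneD F G f 0 ((coneSuccEquiv R _ _ 0).symm (y, z)) =
      (coneZeroEquiv R _ _).symm (G.d 0 y + f 0 z) := by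
  rw [coneD, LinearMap.comp_apply, LinearMap.comp_apply, LinearEquiv.coe_coe,
    LinearEquiv.coe_coe, LinearEquiv.apply_symm_apply, LinearMap.coprod_apply]

theorem coneD_succ_symm (i : ℕ) (y : Fin (G.rank (i + 2)) → R) (z : Fin (F.rank (i + 1)) → R) :
    coneD F G f (i + 1) ((coneSuccEquiv R _ _ (i + 1)).symm (y, z)) =
      (coneSuccEquiv R _ _ i).symm (G.d (i + 1) y + f (i + 1) z, -F.d i z) := by
  rw [coneD, LinearMap.comp_apply, LinearMap.comp_apply, LinearEquiv.coe_coe,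
    LinearEquiv.coe_coe, LinearEquiv.apply_symm_apply]
  rfl

/-- An identification of the resolution `W` with the mapping cone of `f`. -/
structure ConeEquiv (W : MinimalFreeResolution m N) where
  zero : (Fin (W.rank 0) → R) ≃ₗ[R] (Fin (G.rank 0) → R)
  succ : ∀ i, (Fin (W.rank (i + 1)) → R) ≃ₗ[R] (Fin (G.rank (i + 1)) → R) × (Fin (F.rank i) → R)
  d_zero : ∀ y z, W.d 0 ((succ 0).symm (y, z)) = zero.symm (G.d 0 y + f 0 z)
  d_succ : ∀ i y z, W.d (i + 1) ((succ (i + 1)).symm (y, z)) =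
    (succ i).symm (G.d (i + 1) y + f (i + 1) z, -F.d i z)

variable {F G φ lam f}

/-- The mapping cone of a chain map with values in `m G` over an injective map `φ` is a minimal
free resolution of the cokernel of `φ`. -/
def cone (hφ : Function.Injective φ) (hex : Function.Exact φ lam) (hlam : Function.Surjective lam)
    (f0 : ∀ x, G.ε (f 0 x) = φ (F.ε x)) (fd : ∀ i x, G.d i (f (i + 1) x) = f i (F.d i x))
    (fm : ∀ i x, f i x ∈ m • (⊤ : Submodule R (Fin (G.rank i) → R))) :
    MinimalFreeResolution m N where
  rank := coneRank G.rank F.rank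
  d := coneD F G f
  ε := lam ∘ₗ G.ε ∘ₗ (coneZeroEquiv R G.rank F.rank).toLinearMap
  ε_surjective := hlam.comp (G.ε_surjective.comp (coneZeroEquiv R G.rank F.rank).surjective)
  exact_zero := by
    intro x
    obtain ⟨x, rfl⟩ := (coneZeroEquiv R G.rank F.rank).symm.surjective x
    simp only [LinearMap.comp_apply, LinearEquiv.coe_coe, LinearEquiv.apply_symm_apply]
    refine ⟨fun hx => ?_, ?_⟩
    · obtain ⟨u, hu⟩ := (hex _).1 hx
      obtain ⟨z, rfl⟩ := F.ε_surjective u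
      obtain ⟨y, hy⟩ := (G.exact_zero (x - f 0 z)).1 (by rw [map_sub, f0, hu, sub_self])
      exact ⟨(coneSuccEquiv R _ _ 0).symm (y, z), by rw [coneD_zero_symm, hy, sub_add_cancel]⟩
    · rintro ⟨w, hw⟩
      obtain ⟨⟨y, z⟩, rfl⟩ := (coneSuccEquiv R G.rank F.rank 0).symm.surjective w
      rw [coneD_zero_symm] at hw
      rw [← LinearEquiv.injective _ hw, map_add, G.ε_d, f0, zero_add, hex.apply_apply_eq_zero]
  exact_succ := by
    intro i w
    obtain ⟨⟨y, z⟩, rfl⟩ := (coneSuccEquiv R G.rank F.rank i).symm.surjective w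
    refine ⟨fun h => ?_, ?_⟩
    · have key : G.d i y + f i z = 0 ∧ ∃ w, F.d i w = z := by
        rcases i with _ | i
        · rw [coneD_zero_symm, LinearEquiv.map_eq_zero_iff] at h
          refine ⟨h, (F.exact_zero z).1 (hφ ?_)⟩
          rw [← f0, eq_neg_of_add_eq_zero_right h, map_neg, G.ε_d, neg_zero, map_zero]
        · rw [coneD_succ_symm, LinearEquiv.map_eq_zero_iff, Prod.mk_eq_zero, neg_eq_zero] at h
          exact ⟨h.1, (F.exact_succ i z).1 h.2⟩
      obtain ⟨h1, w, rfl⟩ := key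
      obtain ⟨v, hv⟩ := (G.exact_succ i (y + f (i + 1) w)).1 (by rw [map_add, fd, h1])
      refine ⟨(coneSuccEquiv R _ _ (i + 1)).symm (v, -w), ?_⟩
      rw [coneD_succ_symm, hv, map_neg, map_neg, add_neg_cancel_right, neg_neg]
    · rintro ⟨w, hw⟩
      rw [← hw]
      obtain ⟨⟨y, z⟩, rfl⟩ := (coneSuccEquiv R G.rank F.rank (i + 1)).symm.surjective w
      rw [coneD_succ_symm]
      rcases i with _ | i
      · rw [coneD_zero_symm, LinearEquiv.map_eq_zero_iff, map_add, G.d_d, fd, map_neg, zero_add, add_neg_cancel]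
      · rw [coneD_succ_symm, map_add, G.d_d, fd, map_neg, zero_add, add_neg_cancel, map_neg,
          F.d_d, neg_zero, neg_zero, Prod.mk_zero_zero, map_zero]
  minimal := by
    rintro i _ ⟨w, rfl⟩
    obtain ⟨⟨y, z⟩, rfl⟩ := (coneSuccEquiv R G.rank F.rank i).symm.surjective w
    rcases i with _ | i
    · rw [coneD_zero_symm, (coneZeroEquiv R _ _).mem_smul_top_iff, LinearEquiv.apply_symm_apply]
      exact add_mem (G.d_mem _ _) (fm _ _)
    · rw [coneD_succ_symm, (coneSuccEquiv R _ _ i).mem_smul_top_iff_prod,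
        LinearEquiv.apply_symm_apply]
      exact ⟨add_mem (G.d_mem _ _) (fm _ _), neg_mem (F.d_mem _ _)⟩

/-- The tautological identification of `cone` with the mapping cone of `f`. -/
def coneEquiv (hφ : Function.Injective φ) (hex : Function.Exact φ lam)
    (hlam : Function.Surjective lam)
    (f0 : ∀ x, G.ε (f 0 x) = φ (F.ε x)) (fd : ∀ i x, G.d i (f (i + 1) x) = f i (F.d i x))
    (fm : ∀ i x, f i x ∈ m • (⊤ : Submodule R (Fin (G.rank i) → R))) :
    ConeEquiv F G f (cone hφ hex hlam f0 fd fm) where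
  zero := coneZeroEquiv R G.rank F.rank
  succ := coneSuccEquiv R G.rank F.rank
  d_zero := coneD_zero_symm F G f
  d_succ := coneD_succ_symm F G f

/-! ### The linear part of a mapping cone. -/

section Cone

variable {W : MinimalFreeResolution m N} (e : ConeEquiv F G f W)

namespace ConeEquiv

theorem mem_filt_zero (n : ℕ) (y : Fin (G.rank 0) → R) :
    e.zero.symm y ∈ W.filt n 0 ↔ y ∈ G.filt n 0 := by
  rw [filt, e.zero.mem_smul_top_iff, LinearEquiv.apply_symm_apply, filt]

/-- `F_i` sits in cone degree `i + 1`, so its filtration index is shifted together with the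
homological degree. -/
theorem mem_filt_succ (n i : ℕ) (y : Fin (G.rank (i + 1)) → R) (z : Fin (F.rank i) → R) :
    (e.succ i).symm (y, z) ∈ W.filt (n + 1) (i + 1) ↔
      y ∈ G.filt (n + 1) (i + 1) ∧ z ∈ F.filt n i := by
  rw [filt, (e.succ i).mem_smul_top_iff_prod, LinearEquiv.apply_symm_apply,
    Nat.add_sub_add_right, filt, filt, Nat.add_sub_add_right]

theorem exists_filt_iff (s j : ℕ) (y : Fin (G.rank (j + 1)) → R) (z : Fin (F.rank j) → R) :
    (∃ w ∈ W.filt (s + 1) (j + 2),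
      (e.succ j).symm (y, z) - W.d (j + 1) w ∈ W.filt (s + 2) (j + 1)) ↔
    ∃ y' ∈ G.filt (s + 1) (j + 2), ∃ z' ∈ F.filt s (j + 1),
      y - (G.d (j + 1) y' + f (j + 1) z') ∈ G.filt (s + 2) (j + 1) ∧
      z + F.d j z' ∈ F.filt (s + 1) j := by
  constructor
  · rintro ⟨w, hw, hw'⟩
    obtain ⟨⟨y', z'⟩, rfl⟩ := (e.succ (j + 1)).symm.surjective w
    rw [e.d_succ, ← map_sub, Prod.mk_sub_mk, e.mem_filt_succ, sub_neg_eq_add] at hw'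
    rw [e.mem_filt_succ] at hw
    exact ⟨y', hw.1, z', hw.2, hw'⟩
  · rintro ⟨y', hy', z', hz', h⟩
    refine ⟨(e.succ (j + 1)).symm (y', z'), (e.mem_filt_succ _ _ _ _).2 ⟨hy', hz'⟩, ?_⟩
    rwa [e.d_succ, ← map_sub, Prod.mk_sub_mk, e.mem_filt_succ, sub_neg_eq_add]

/-- Unlike in higher degrees, no cycle condition falls on `z`: here all of `F_0` competes, which is
where `gr M` enters. Strand `0` is covered by `linExact_of_le`. -/
theorem linExact_zero_iff (e : ConeEquiv F G f W) (s : ℕ) :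
    W.LinExact (s + 1) 0 ↔
      ∀ y ∈ G.filt (s + 1) 1, ∀ z ∈ F.filt s 0, G.d 0 y + f 0 z ∈ G.filt (s + 2) 0 →
        ∃ y' ∈ G.filt (s + 1) 2, ∃ z' ∈ F.filt s 1,
          y - (G.d 1 y' + f 1 z') ∈ G.filt (s + 2) 1 ∧ z + F.d 0 z' ∈ F.filt (s + 1) 0 := by
  refine (e.succ 0).forall_prod.trans (forall_congr' fun y => ?_)
  simp only [e.mem_filt_succ, e.d_zero, e.mem_filt_zero, e.exists_filt_iff, and_imp]
  exact ⟨fun h hy z => h z hy, fun h z hy => h hy z⟩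

theorem linExact_succ_iff (e : ConeEquiv F G f W) (s j : ℕ) :
    W.LinExact (s + 1) (j + 1) ↔
      ∀ y ∈ G.filt (s + 1) (j + 2), ∀ z ∈ F.filt s (j + 1),
        G.d (j + 1) y + f (j + 1) z ∈ G.filt (s + 2) (j + 1) → F.d j z ∈ F.filt (s + 1) j →
        ∃ y' ∈ G.filt (s + 1) (j + 3), ∃ z' ∈ F.filt s (j + 2),
          y - (G.d (j + 2) y' + f (j + 2) z') ∈ G.filt (s + 2) (j + 2) ∧
          z + F.d (j + 1) z' ∈ F.filt (s + 1) (j + 1) := by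
  refine (e.succ (j + 1)).forall_prod.trans (forall_congr' fun y => ?_)
  simp only [e.mem_filt_succ, e.d_succ, e.exists_filt_iff, and_imp, neg_mem_iff]
  exact ⟨fun h hy z => h z hy, fun h z hy => h hy z⟩

end ConeEquiv

theorem chainMap_mem_filt_succ (fm : ∀ i x, f i x ∈ m • (⊤ : Submodule R (Fin (G.rank i) → R)))
    {n i : ℕ} {x : Fin (F.rank i) → R} (hx : x ∈ F.filt n i) : f i x ∈ G.filt (n + 1) i :=
  Submodule.pow_smul_top_antitone (by omega : n + 1 - i ≤ n - i + 1)
    (Submodule.map_mem_pow_succ_smul_top (fm i) hx)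

/-- In the presence of linear exactness in homological degree one, `d 0` is strict. -/
theorem exists_mem_pow_of_d_mem (hF : ∀ n, F.LinExact n 0) (n : ℕ) {w : Fin (F.rank 1) → R}
    (hw : F.d 0 w ∈ F.filt n 0) : ∃ w' ∈ F.filt n 1, F.d 0 w' = F.d 0 w := by
  induction n with
  | zero => exact ⟨w, by rw [F.filt_eq_top (by omega)]; trivial, rfl⟩
  | succ n ih =>
    obtain ⟨w', hw', h⟩ := ih (F.filt_antitone (Nat.le_succ n) 0 hw)
    obtain ⟨y, -, hy⟩ := hF n w' hw' (h ▸ hw)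
    exact ⟨_, hy, by rw [map_sub, F.d_d, sub_zero, h]⟩

/-- This is the long exact homology sequence of `lin G → lin W → lin F[-1]` done on elements, the
terms from `lin G` being zero. -/
theorem ConeEquiv.linExact_succ (e : ConeEquiv F G f W)
    (fd : ∀ i x, G.d i (f (i + 1) x) = f i (F.d i x))
    (fm : ∀ i x, f i x ∈ m • (⊤ : Submodule R (Fin (G.rank i) → R)))
    (hG : ∀ i n, G.LinExact n i) (j : ℕ) :
    (∀ n, W.LinExact n (j + 1)) ↔ ∀ n, F.LinExact n j := by
  constructor
  · intro h s
    rcases le_or_gt s j with hs | hs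
    · exact F.linExact_of_le hs
    intro z hz hdz
    -- The cycle `z` maps to a cycle of `lin G`, hence a boundary `d y`; thus `(-y, z)` is a cycle
    -- of the cone.
    obtain ⟨y, hy, hyz⟩ := hG j (s + 1) (f (j + 1) z) (chainMap_mem_filt_succ fm hz)
      (by rw [fd]; exact chainMap_mem_filt_succ fm hdz)
    obtain ⟨-, -, z', hz', -, hz''⟩ := (e.linExact_succ_iff s j).1 (h (s + 1)) (-y)
      (neg_mem hy) z hz (by rwa [map_neg, neg_add_eq_sub]) hdz
    exact ⟨-z', neg_mem hz', by rwa [map_neg, sub_neg_eq_add]⟩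
  · rintro h (_ | s)
    · exact linExact_of_le _ (Nat.zero_le _)
    refine (e.linExact_succ_iff s j).2 fun y hy z hz hyz hdz => ?_
    obtain ⟨z', hz', hz''⟩ := h s z hz hdz
    -- Subtracting the boundary of `(0, -z')` removes the `F`-component and leaves a cycle of `lin
    -- G`.
    have hd : G.d (j + 1) (y + f (j + 2) z') ∈ G.filt (s + 2) (j + 1) := by
      convert sub_mem hyz (chainMap_mem_filt_succ fm hz'') using 1
      simp only [map_add, map_sub, fd]
      abel
    obtain ⟨y', hy', hy''⟩ := hG (j + 1) (s + 1) (y + f (j + 2) z')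
      (add_mem hy (chainMap_mem_filt_succ fm hz')) hd
    refine ⟨y', hy', -z', neg_mem hz', ?_, by rwa [map_neg, ← sub_eq_add_neg]⟩
    convert hy'' using 1
    rw [map_neg]
    abel

/-- The right side is injectivity of `gr M → gr P` in each degree. It computes `H_1` because
strictness of `d 0` identifies `H_0(lin F)` with `gr M`, and likewise for `G`. -/
theorem ConeEquiv.linExact_zero (e : ConeEquiv F G f W)
    (f0 : ∀ x, G.ε (f 0 x) = φ (F.ε x)) (fd : ∀ i x, G.d i (f (i + 1) x) = f i (F.d i x))
    (fm : ∀ i x, f i x ∈ m • (⊤ : Submodule R (Fin (G.rank i) → R)))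
    (hF : ∀ i n, F.LinExact n i) (hG : ∀ i n, G.LinExact n i) :
    (∀ n, W.LinExact n 0) ↔
      ∀ s, ∀ u ∈ m ^ s • (⊤ : Submodule R M), φ u ∈ m ^ (s + 2) • (⊤ : Submodule R P) →
        u ∈ m ^ (s + 1) • (⊤ : Submodule R M) := by
  constructor
  · intro h s u hu hφu
    obtain ⟨z, hz, rfl⟩ := Submodule.exists_mem_smul_top_of_surjective F.ε_surjective hu
    obtain ⟨q, hq, hqu⟩ := Submodule.exists_mem_smul_top_of_surjective G.ε_surjective hφu
    replace hz : z ∈ F.filt s 0 := hz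
    replace hq : q ∈ G.filt (s + 2) 0 := hq
    obtain ⟨y, hy⟩ := (G.exact_zero (q - f 0 z)).1 (by rw [map_sub, hqu, f0, sub_self])
    -- Strictness replaces `y` by a preimage deep enough in the filtration for `(y', z)` to define a
    -- cycle in strand `s + 1`.
    obtain ⟨y', hy', hyy⟩ := exists_mem_pow_of_d_mem (hG 0) (s + 1) (w := y) (by
      rw [hy]
      exact sub_mem (G.filt_antitone (Nat.le_succ _) 0 hq) (chainMap_mem_filt_succ fm hz))
    obtain ⟨-, -, z', -, -, hz'⟩ := (e.linExact_zero_iff s).1 (h (s + 1)) y' hy' z hz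
      (by rwa [hyy, hy, sub_add_cancel])
    have : F.ε z = F.ε (z + F.d 0 z') := by rw [map_add, F.ε_d, add_zero]
    rw [this]
    exact Submodule.map_mem_smul_top F.ε hz'
  · rintro h (_ | s)
    · exact linExact_of_le _ le_rfl
    refine (e.linExact_zero_iff s).2 fun y hy z hz hyz => ?_
    have h1 := h s (F.ε z) (Submodule.map_mem_smul_top F.ε hz) (by
      have h2 := Submodule.map_mem_smul_top G.ε hyz
      rwa [map_add, G.ε_d, zero_add, f0] at h2)
    obtain ⟨z₁, hz₁, hzz⟩ := Submodule.exists_mem_smul_top_of_surjective F.ε_surjective h1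
    replace hz₁ : z₁ ∈ F.filt (s + 1) 0 := hz₁
    obtain ⟨w, hw⟩ := (F.exact_zero (z - z₁)).1 (by rw [map_sub, hzz, sub_self])
    -- `z` and the deeper lift `z₁` differ by a boundary, which strictness realises within the
    -- filtration; so `z` bounds modulo `z₁`.
    obtain ⟨z', hz', hdz'⟩ := exists_mem_pow_of_d_mem (hF 0) s (w := w) (by
      rw [hw]
      exact sub_mem hz (F.filt_antitone (Nat.le_succ _) 0 hz₁))
    rw [hw] at hdz'
    obtain ⟨y', hy', hy''⟩ := hG 0 (s + 1) (y + f 1 z')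
      (add_mem hy (chainMap_mem_filt_succ fm hz')) (by
        have h1 := sub_mem hyz (chainMap_mem_filt_succ fm hz₁)
        convert h1 using 1
        simp only [map_add, fd, hdz', map_sub]
        abel)
    refine ⟨y', hy', -z', neg_mem hz', ?_, ?_⟩
    · convert hy'' using 1
      rw [map_neg]
      abel
    · rw [map_neg, hdz']
      convert hz₁ using 1
      abel

end Cone

/-! ### Comparison of linearity defects. -/

/-- A map into a Koszul module with image in `m P` lifts to a chain map with values in `m G`. -/
theorem exists_chainMap_mem (F : MinimalFreeResolution m M) (hG : ∀ i n, G.LinExact n i)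
    (hφ : LinearMap.range φ ≤ m • ⊤) :
    ∃ f : ∀ i, (Fin (F.rank i) → R) →ₗ[R] (Fin (G.rank i) → R),
      (∀ x, G.ε (f 0 x) = φ (F.ε x)) ∧ (∀ i x, G.d i (f (i + 1) x) = f i (F.d i x)) ∧
      ∀ i x, f i x ∈ m • (⊤ : Submodule R (Fin (G.rank i) → R)) := by
  refine exists_chainMap F G φ (fun i => m • ⊤) (fun x => ?_) ?_
  · exact Submodule.exists_mem_smul_top_of_surjective G.ε_surjective
      (hφ (LinearMap.mem_range_self _ _))
  · rintro i _ hx ⟨y, rfl⟩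
    -- In strand `i + 1` all of `G_{i+1}` is available and `d y ∈ m² G_i` says that `y` is a cycle;
    -- modulo a boundary, `y` lies in `m G_{i+1}`.
    obtain ⟨y', -, hy'⟩ := hG i (i + 1) y (by rw [G.filt_eq_top le_rfl]; trivial) (by
      rw [filt, show i + 1 + 1 - i = 2 by omega, pow_two, Submodule.mul_smul]
      exact hx)
    refine ⟨y - G.d (i + 1) y', ?_, by rw [map_sub, G.d_d, sub_zero]⟩
    rwa [filt, show i + 1 + 1 - (i + 1) = 1 by omega, pow_one] at hy'

/-- Injectivity on graded pieces lifts an element of `M ∩ m^(s+1) P` one power at a time from `M`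
into `m^s M`. The opposite inclusion is `M ⊆ mP` multiplied by `m^s`. -/
theorem inf_pow_smul_eq_map_iff (hφ : Function.Injective φ)
    (hφm : LinearMap.range φ ≤ m • ⊤) :
    (∀ s : ℕ, LinearMap.range φ ⊓ (m ^ (s + 1) • (⊤ : Submodule R P)) =
        (m ^ s • (⊤ : Submodule R M)).map φ) ↔
      ∀ s, ∀ u ∈ m ^ s • (⊤ : Submodule R M), φ u ∈ m ^ (s + 2) • (⊤ : Submodule R P) →
        u ∈ m ^ (s + 1) • (⊤ : Submodule R M) := by
  constructor
  · intro h s u _ hu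
    obtain ⟨v, hv, hvu⟩ := (h (s + 1)).le ⟨⟨u, rfl⟩, hu⟩
    exact hφ hvu ▸ hv
  · intro h s
    refine le_antisymm ?_ (le_inf LinearMap.map_le_range ?_)
    · induction s with
      | zero =>
        rintro _ ⟨⟨u, rfl⟩, -⟩
        exact ⟨u, by simp, rfl⟩
      | succ s ih =>
        rintro _ ⟨⟨u, rfl⟩, hu⟩
        obtain ⟨v, hv, hvu⟩ := ih ⟨⟨u, rfl⟩, Submodule.pow_smul_top_antitone (Nat.le_succ _) hu⟩
        rw [← hvu] at hu ⊢
        exact ⟨v, h s v hv hu, rfl⟩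
    · rw [Submodule.map_smul'', Submodule.map_top, pow_succ, Submodule.mul_smul]
      exact Submodule.smul_mono le_rfl hφm

/-- The comparison of linearity defects, for chosen minimal resolutions. -/
theorem linearityDefect_of_exact (F : MinimalFreeResolution m M) (G : MinimalFreeResolution m P)
    (H : MinimalFreeResolution m N) (hφ : Function.Injective φ) (hex : Function.Exact φ lam)
    (hlam : Function.Surjective lam) (hG : G.linearityDefect = 0)
    (hφm : LinearMap.range φ ≤ m • (⊤ : Submodule R P)) :
    (H.linearityDefect ≤ F.linearityDefect + 1 ∧
      F.linearityDefect ≤ max 0 (H.linearityDefect - 1)) ∧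
    (1 ≤ F.linearityDefect → H.linearityDefect = F.linearityDefect + 1) ∧
    (F.linearityDefect = 0 → H.linearityDefect ≤ 1) ∧
    (H.linearityDefect = 0 ↔ F.linearityDefect = 0 ∧ ∀ s : ℕ,
      LinearMap.range φ ⊓ (m ^ (s + 1) • (⊤ : Submodule R P)) =
        (m ^ s • (⊤ : Submodule R M)).map φ) := by
  rw [linearityDefect_eq_zero_iff] at hG
  obtain ⟨f, f0, fd, fm⟩ := exists_chainMap_mem F hG hφm
  rw [H.linearityDefect_eq (cone hφ hex hlam f0 fd fm)]
  have e := coneEquiv hφ hex hlam f0 fd fm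
  generalize cone hφ hex hlam f0 fd fm = W at e ⊢
  -- The bound `t + 1` on the cone never involves its `H_1`, so only the degree shift of
  -- `linExact_succ` matters.
  have key : ∀ t : ℕ, W.linearityDefect ≤ t + 1 ↔ F.linearityDefect ≤ t := by
    intro t
    rw [← Nat.cast_succ, linearityDefect_le_iff, linearityDefect_le_iff]
    constructor
    · intro h i hi
      exact (e.linExact_succ fd fm hG i).1 (h (i + 1) (by omega))
    · rintro h (_ | i) hi
      · omega
      · exact (e.linExact_succ fd fm hG i).2 (h i (by omega))
  have h1 : W.linearityDefect ≤ F.linearityDefect + 1 := by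
    induction hF : F.linearityDefect using ENat.recTopCoe with
    | top => simp
    | coe t => exact (key t).2 hF.le
  have h2 : F.linearityDefect ≤ W.linearityDefect - 1 := by
    induction hW : W.linearityDefect using ENat.recTopCoe with
    | top => simp
    | coe t =>
      have h3 := (key (t - 1)).1 (by rw [hW]; exact_mod_cast (by omega : t ≤ t - 1 + 1))
      exact_mod_cast h3
  have h3 : F.linearityDefect = 0 → W.linearityDefect ≤ 1 := fun h => by simpa [h] using h1
  refine ⟨⟨h1, h2.trans (le_max_right _ _)⟩, fun h => le_antisymm h1 ?_, h3, ?_⟩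
  · have h4 : (1 : ℕ∞) ≤ W.linearityDefect := h.trans (h2.trans tsub_le_self)
    calc F.linearityDefect + 1 ≤ W.linearityDefect - 1 + 1 := by gcongr
      _ = W.linearityDefect := tsub_add_cancel_of_le h4
  · rw [inf_pow_smul_eq_map_iff hφ hφm]
    constructor
    · intro h
      have hF : F.linearityDefect = 0 := by
        rw [h] at h2
        simpa using h2
      refine ⟨hF, (e.linExact_zero f0 fd fm ?_ hG).1 ?_⟩
      · exact F.linearityDefect_eq_zero_iff.1 hF
      · exact W.linearityDefect_eq_zero_iff.1 h 0
    · rintro ⟨hF, hs⟩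
      rw [linearityDefect_eq_zero_iff] at hF ⊢
      rintro (_ | i)
      · exact (e.linExact_zero f0 fd fm hF hG).2 hs
      · exact (e.linExact_succ fd fm hG i).2 (hF i)

end MinimalFreeResolution

/-! ### Existence of minimal resolutions: local case. -/

/-- A finitely generated submodule with generators satisfying `p` has a minimal such system of
generators: no relation between them has an invertible coefficient. -/
theorem Submodule.exists_minimal_generators {R E : Type*} [CommRing R] [AddCommGroup E]
    [Module R E] (p : E → Prop) (S : Finset E) (hS : ∀ x ∈ S, p x) :
    ∃ (b : ℕ) (g : Fin b → E), (∀ j, p (g j)) ∧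
      Submodule.span R (Set.range g) = Submodule.span R S ∧
      ∀ x : Fin b → R, ∑ j, x j • g j = 0 → ∀ j, ¬ IsUnit (x j) := by
  classical
  have hex : ∃ (b : ℕ) (g : Fin b → E), (∀ j, p (g j)) ∧
      Submodule.span R (Set.range g) = Submodule.span R S := by
    refine ⟨S.card, fun j => (S.equivFin.symm j : E), fun j => hS _ (S.equivFin.symm j).2, ?_⟩
    congr 1
    ext x
    constructor
    · rintro ⟨j, rfl⟩
      exact (S.equivFin.symm j).2
    · intro hx
      exact ⟨S.equivFin ⟨x, hx⟩, by simp⟩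
  obtain ⟨g, hg, hspan⟩ := Nat.find_spec hex
  refine ⟨Nat.find hex, g, hg, hspan, ?_⟩
  have hmin := fun b' => @Nat.find_min _ _ hex b'
  revert g hmin
  generalize Nat.find hex = b
  intro g hg hspan hmin x hx j hu
  rcases b with _ | b
  · exact j.elim0
  -- An invertible coefficient makes `g j` redundant, against the minimal number of generators.
  refine hmin b (Nat.lt_succ_self b) ⟨g ∘ j.succAbove, fun i => hg _, hspan ▸ le_antisymm ?_ ?_⟩
  · exact Submodule.span_mono (Set.range_comp_subset_range _ _)
  · rw [Submodule.span_le]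
    have hj : g j ∈ Submodule.span R (Set.range (g ∘ j.succAbove)) := by
      rw [Fin.sum_univ_succAbove _ j] at hx
      have h1 : x j • g j ∈ Submodule.span R (Set.range (g ∘ j.succAbove)) := by
        rw [eq_neg_of_add_eq_zero_left hx]
        exact neg_mem (sum_mem fun i _ =>
          Submodule.smul_mem _ _ (Submodule.subset_span ⟨i, rfl⟩))
      obtain ⟨u, hu⟩ := hu
      have h2 := Submodule.smul_mem _ (↑u⁻¹ : R) h1
      rwa [← hu, smul_smul, Units.inv_mul, one_smul] at h2
    rintro _ ⟨i, rfl⟩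
    rcases Fin.eq_self_or_eq_succAbove j i with rfl | ⟨i', rfl⟩
    · exact hj
    · exact Submodule.subset_span ⟨i', rfl⟩

theorem mem_smul_top_of_forall_mem {R : Type*} [CommRing R] {b : ℕ} {I : Ideal R}
    {x : Fin b → R} (h : ∀ j, x j ∈ I) : x ∈ I • (⊤ : Submodule R (Fin b → R)) := by
  rw [pi_eq_sum_univ' x]
  exact sum_mem fun j _ => Submodule.smul_mem_smul (h j) trivial

namespace MinimalFreeResolution

/-- Iterated construction of a minimal free resolution, carrying along data `D` on the bases. -/
theorem exists_of_step {R : Type*} [CommRing R] {m : Ideal R} {M : Type*} [AddCommGroup M]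
    [Module R M] {D : ℕ → Type} (Q : ∀ b, D b → Submodule R (Fin b → R) → Prop)
    (L : ∀ {b b'}, D b → D b' → ((Fin b' → R) →ₗ[R] (Fin b → R)) → Prop)
    (L₀ : ∀ {b}, D b → ((Fin b → R) →ₗ[R] M) → Prop)
    (hQ : ∀ b a K, Q b a K → K ≤ m • ⊤)
    (step : ∀ b a K, Q b a K → ∃ (b' : ℕ) (a' : D b') (δ : (Fin b' → R) →ₗ[R] (Fin b → R)),
      LinearMap.range δ = K ∧ L a a' δ ∧ Q b' a' (LinearMap.ker δ))
    (start : ∃ (b : ℕ) (a : D b) (ε : (Fin b → R) →ₗ[R] M),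
      LinearMap.range ε = ⊤ ∧ L₀ a ε ∧ Q b a (LinearMap.ker ε)) :
    ∃ (F : MinimalFreeResolution m M) (a : ∀ i, D (F.rank i)),
      (∀ i, L (a i) (a (i + 1)) (F.d i)) ∧ L₀ (a 0) F.ε := by
  -- A state is a free module with its basis data and the submodule still to be covered, namely the
  -- last kernel.
  let T := Σ b : ℕ, {s : D b × Submodule R (Fin b → R) // Q b s.1 s.2}
  have step' : ∀ t : T, ∃ (t' : T) (δ : (Fin t'.1 → R) →ₗ[R] (Fin t.1 → R)),
      LinearMap.range δ = t.2.1.2 ∧ L t.2.1.1 t'.2.1.1 δ ∧ t'.2.1.2 = LinearMap.ker δ := by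
    rintro ⟨b, ⟨a, K⟩, h⟩
    obtain ⟨b', a', δ, h1, h2, h3⟩ := step b a K h
    exact ⟨⟨b', ⟨a', _⟩, h3⟩, δ, h1, h2, rfl⟩
  choose next δ hrange hL hker using step'
  obtain ⟨b, a, ε, h1, h2, h3⟩ := start
  let s : ℕ → T := fun i => Nat.rec ⟨b, ⟨a, _⟩, h3⟩ (fun _ => next) i
  exact ⟨⟨fun i => (s i).1, fun i => δ (s i), ε, LinearMap.range_eq_top.1 h1,
    LinearMap.exact_iff.2 (hrange (s 0)).symm,
    fun i => LinearMap.exact_iff.2 ((hker (s i)).symm.trans (hrange (s (i + 1))).symm),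
    fun i => (hrange (s i)).le.trans (hQ _ _ _ (s i).2.2)⟩,
    fun i => (s i).2.1.1, fun i => hL (s i), h2⟩

/-- Minimal free covers over a local ring. -/
theorem exists_cover_of_isLocalRing {R : Type*} [CommRing R] [IsLocalRing R]
    {E : Type*} [AddCommGroup E] [Module R E] {K : Submodule R E} (hK : K.FG) :
    ∃ (b : ℕ) (δ : (Fin b → R) →ₗ[R] E), LinearMap.range δ = K ∧
      LinearMap.ker δ ≤ IsLocalRing.maximalIdeal R • ⊤ := by
  obtain ⟨S, rfl⟩ := hK
  obtain ⟨b, g, -, hg, hmin⟩ := Submodule.exists_minimal_generators (R := R) (fun _ => True) S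
    (fun _ _ => trivial)
  refine ⟨b, Fintype.linearCombination R g, ?_, fun x hx => ?_⟩
  · rw [Fintype.range_linearCombination, hg]
  · exact mem_smul_top_of_forall_mem (hmin x hx)

/-- Minimal free resolutions exist over noetherian local rings. -/
theorem exists_of_isLocalRing (R : Type*) [CommRing R] [IsLocalRing R] [IsNoetherianRing R]
    (M : Type*) [AddCommGroup M] [Module R M] [Module.Finite R M] :
    Nonempty (MinimalFreeResolution (IsLocalRing.maximalIdeal R) M) := by
  obtain ⟨F, -⟩ := exists_of_step (m := IsLocalRing.maximalIdeal R) (M := M) (D := fun _ => Unit)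
    (fun _ _ K => K ≤ IsLocalRing.maximalIdeal R • ⊤) (fun _ _ _ => True) (fun _ _ => True)
    (fun _ _ _ h => h)
    (fun b _ K _ => by
      obtain ⟨b', δ, h1, h2⟩ := exists_cover_of_isLocalRing (IsNoetherian.noetherian K)
      exact ⟨b', (), δ, h1, trivial, h2⟩)
    (by
      obtain ⟨b', δ, h1, h2⟩ := exists_cover_of_isLocalRing (Module.Finite.fg_top (R := R) (M := M))
      exact ⟨b', (), δ, h1, trivial, h2⟩)
  exact ⟨F⟩

end MinimalFreeResolution

/-! ### Existence of minimal resolutions: graded case. -/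

section Graded

variable {k R : Type*} [Field k] [CommRing R] [Algebra k R] (𝒜 : ℕ → Submodule k R)

theorem IsStandardGraded.isNoetherianRing {𝒜 : ℕ → Submodule k R} [GradedAlgebra 𝒜]
    (h : IsStandardGraded 𝒜) : IsNoetherianRing R := by
  have := h.finite_one
  obtain ⟨S, hS⟩ := (Submodule.fg_iff_finiteDimensional (𝒜 1)).2 this
  have : Algebra.FiniteType k R := ⟨⟨S, by
    rw [← Algebra.adjoin_span, hS, h.adjoin_one]⟩⟩
  exact Algebra.FiniteType.isNoetherianRing k R

/-- `π` is the family of projections onto the components of the `ℤ`-graded `R`-module `E`. -/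
structure IsGradingProjection {E : Type*} [AddCommGroup E] [Module R E] (ℰ : ℤ → AddSubgroup E)
    (π : ℤ → E →+ E) : Prop where
  mem : ∀ n x, π n x ∈ ℰ n
  same : ∀ n, ∀ x ∈ ℰ n, π n x = x
  of_ne : ∀ i n, i ≠ n → ∀ x ∈ ℰ i, π n x = 0
  exists_sum_eq : ∀ x, ∃ s : Finset ℤ, ∀ t, s ⊆ t → ∑ n ∈ t, π n x = x
  smul_mem : ∀ (i : ℕ) (j : ℤ) (a : R) (x : E), a ∈ 𝒜 i → x ∈ ℰ j → a • x ∈ ℰ (i + j)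

variable {𝒜}

/-- Allowing every larger index set `t` lets the supports of two summands be merged. -/
theorem exists_sum_eq_of_mem_closure {E : Type*} [AddCommGroup E] {ℰ : ℤ → AddSubgroup E}
    {π : ℤ → E →+ E} (same : ∀ n, ∀ x ∈ ℰ n, π n x = x)
    (of_ne : ∀ i n, i ≠ n → ∀ x ∈ ℰ i, π n x = 0) {x : E}
    (hx : x ∈ AddSubgroup.closure (⋃ n, (ℰ n : Set E))) :
    ∃ s : Finset ℤ, ∀ t, s ⊆ t → ∑ n ∈ t, π n x = x := by
  classical
  induction hx using AddSubgroup.closure_induction with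
  | mem x hx =>
    obtain ⟨i, hi⟩ := Set.mem_iUnion.1 hx
    refine ⟨{i}, fun t ht => ?_⟩
    rw [Finset.sum_eq_single_of_mem i (ht (Finset.mem_singleton_self i))
      (fun n _ hn => of_ne i n hn.symm x hi), same i x hi]
  | zero => exact ⟨∅, fun t _ => by simp⟩
  | add x y _ _ hx hy =>
    obtain ⟨s, hs⟩ := hx
    obtain ⟨s', hs'⟩ := hy
    refine ⟨s ∪ s', fun t ht => ?_⟩
    simp only [map_add, Finset.sum_add_distrib]
    rw [hs t (Finset.union_subset_left ht), hs' t (Finset.union_subset_right ht)]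
  | neg x _ hx =>
    obtain ⟨s, hs⟩ := hx
    exact ⟨s, fun t ht => by simp [hs t ht]⟩

theorem IsGradedModule.exists_isGradingProjection {M : Type*} [AddCommGroup M] [Module R M]
    {ℳ : ℤ → AddSubgroup M} (h : IsGradedModule 𝒜 ℳ) : ∃ π, IsGradingProjection 𝒜 ℳ π := by
  classical
  let _ := h.isInternal.chooseDecomposition
  let π : ℤ → M →+ M := fun n => (ℳ n).subtype.comp
    ((DFinsupp.evalAddMonoidHom n).comp (DirectSum.decomposeAddEquiv ℳ).toAddMonoidHom)
  have hπ : ∀ n x, π n x = DirectSum.decompose ℳ x n := fun _ _ => rfl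
  have same : ∀ n, ∀ x ∈ ℳ n, π n x = x := fun n x hx => by
    rw [hπ, DirectSum.decompose_of_mem_same _ hx]
  have of_ne : ∀ i n, i ≠ n → ∀ x ∈ ℳ i, π n x = 0 := fun i n hi x hx => by
    rw [hπ, DirectSum.decompose_of_mem_ne _ hx hi]
  refine ⟨π, fun n x => (DirectSum.decompose ℳ x n).2, same, of_ne, fun x => ?_, h.smul_mem⟩
  refine exists_sum_eq_of_mem_closure same of_ne ?_
  rw [← DirectSum.sum_support_decompose ℳ x]
  exact sum_mem fun n _ => AddSubgroup.subset_closure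
    (Set.mem_iUnion.2 ⟨n, (DirectSum.decompose ℳ x n).2⟩)

theorem IsGradingProjection.map_comm {E E' : Type*} [AddCommGroup E] [Module R E]
    [AddCommGroup E'] [Module R E'] {ℰ : ℤ → AddSubgroup E} {ℰ' : ℤ → AddSubgroup E'}
    {π : ℤ → E →+ E} {π' : ℤ → E' →+ E'} (h : IsGradingProjection 𝒜 ℰ π)
    (h' : IsGradingProjection 𝒜 ℰ' π') {f : E →ₗ[R] E'} (hf : IsGradedMap ℰ ℰ' f) (n : ℤ) (x : E) :
    f (π n x) = π' n (f x) := by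
  classical
  obtain ⟨s, hs⟩ := h.exists_sum_eq x
  conv_rhs => rw [← hs (insert n s) (Finset.subset_insert n s), map_sum, map_sum]
  rw [Finset.sum_eq_single_of_mem n (Finset.mem_insert_self n s)
    (fun i _ hi => h'.of_ne i n hi _ (hf i _ (h.mem i x)))]
  exact (h'.same n _ (hf n _ (h.mem n x))).symm

variable [GradedAlgebra 𝒜]

variable (𝒜) in
/-- The projection of a graded free module onto its component of degree `n`. -/
def freeGradingProjection {b : ℕ} (a : Fin b → ℤ) (n : ℤ) : (Fin b → R) →+ (Fin b → R) :=
  AddMonoidHom.pi fun j =>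
    if a j ≤ n then (GradedRing.proj 𝒜 (n - a j).toNat).comp (Pi.evalAddMonoidHom _ j) else 0

theorem freeGradingProjection_apply_of_le {b : ℕ} {a : Fin b → ℤ} {n : ℤ} {j : Fin b}
    (h : a j ≤ n) (x : Fin b → R) :
    freeGradingProjection 𝒜 a n x j = GradedRing.proj 𝒜 (n - a j).toNat (x j) := by
  simp [freeGradingProjection, AddMonoidHom.pi_apply, h]

theorem freeGradingProjection_apply_of_lt {b : ℕ} {a : Fin b → ℤ} {n : ℤ} {j : Fin b}
    (h : n < a j) (x : Fin b → R) : freeGradingProjection 𝒜 a n x j = 0 := by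
  simp [freeGradingProjection, AddMonoidHom.pi_apply, not_le.2 h]

theorem isGradingProjection_free {b : ℕ} (a : Fin b → ℤ) :
    IsGradingProjection 𝒜 (freeGrading 𝒜 a) (freeGradingProjection 𝒜 a) := by
  classical
  have same : ∀ n, ∀ x ∈ freeGrading 𝒜 a n, freeGradingProjection 𝒜 a n x = x := by
    intro n x hx
    ext j
    rcases le_or_gt (a j) n with h | h
    · rw [freeGradingProjection_apply_of_le h, GradedRing.proj_apply,
        DirectSum.decompose_of_mem_same _ ((hx j).1 h)]
    · rw [freeGradingProjection_apply_of_lt h, (hx j).2 h]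
  have of_ne : ∀ i n, i ≠ n → ∀ x ∈ freeGrading 𝒜 a i, freeGradingProjection 𝒜 a n x = 0 := by
    intro i n hi x hx
    ext j
    rcases le_or_gt (a j) n with h | h
    · rw [freeGradingProjection_apply_of_le h, GradedRing.proj_apply, Pi.zero_apply]
      rcases le_or_gt (a j) i with h' | h'
      · exact DirectSum.decompose_of_mem_ne _ ((hx j).1 h') (by omega)
      · rw [(hx j).2 h', DirectSum.decompose_zero]
        rfl
    · rw [freeGradingProjection_apply_of_lt h, Pi.zero_apply]
  refine ⟨fun n x j => ⟨fun h => ?_, fun h => freeGradingProjection_apply_of_lt h x⟩, same, of_ne,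
    fun x => exists_sum_eq_of_mem_closure same of_ne ?_, fun i n c x hc hx j => ⟨fun h => ?_,
    fun h => ?_⟩⟩
  · rw [freeGradingProjection_apply_of_le h]
    exact (DirectSum.decompose 𝒜 (x j) _).2
  · rw [← Finset.univ_sum_single x]
    refine sum_mem fun j _ => ?_
    rw [← DirectSum.sum_support_decompose 𝒜 (x j), ← AddMonoidHom.single_apply, map_sum]
    refine sum_mem fun i _ => AddSubgroup.subset_closure (Set.mem_iUnion.2 ⟨a j + i, fun l => ?_⟩)
    rw [AddMonoidHom.single_apply]
    rcases eq_or_ne l j with rfl | hl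
    · rw [Pi.single_eq_same]
      refine ⟨fun _ => ?_, fun h => by omega⟩
      rw [show (a l + i - a l).toNat = i by omega]
      exact (DirectSum.decompose 𝒜 (x l) i).2
    · rw [Pi.single_eq_of_ne hl]
      exact ⟨fun _ => zero_mem _, fun _ => rfl⟩
  · rw [Pi.smul_apply, smul_eq_mul]
    rcases le_or_gt (a j) n with h' | h'
    · rw [show (i + n - a j).toNat = i + (n - a j).toNat by omega]
      exact SetLike.mul_mem_graded hc ((hx j).1 h')
    · rw [(hx j).2 h', mul_zero]
      exact zero_mem _
  · rw [Pi.smul_apply, (hx j).2 (by omega), smul_zero]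

/-- Minimal graded free covers over a standard graded algebra. -/
theorem IsGradingProjection.exists_cover (hA : IsStandardGraded 𝒜) {E : Type*} [AddCommGroup E]
    [Module R E] {ℰ : ℤ → AddSubgroup E} {π : ℤ → E →+ E} (h : IsGradingProjection 𝒜 ℰ π)
    {K : Submodule R E} (hK : K.FG) (hKπ : ∀ n, ∀ x ∈ K, π n x ∈ K) :
    ∃ (b : ℕ) (a : Fin b → ℤ) (δ : (Fin b → R) →ₗ[R] E), LinearMap.range δ = K ∧
      IsGradedMap (freeGrading 𝒜 a) ℰ δ ∧
      LinearMap.ker δ ≤ (HomogeneousIdeal.irrelevant 𝒜).toIdeal • ⊤ ∧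
      ∀ n, ∀ x ∈ LinearMap.ker δ, freeGradingProjection 𝒜 a n x ∈ LinearMap.ker δ := by
  classical
  obtain ⟨S, rfl⟩ := hK
  choose s hs using h.exists_sum_eq
  -- Homogeneous components of the generators stay in `K` by `hKπ`, so they form a homogeneous
  -- generating set.
  let T : Finset E := S.biUnion fun x => (s x).image fun n => π n x
  have hT : ∀ y ∈ T, ∃ n, y ∈ ℰ n := by
    intro y hy
    obtain ⟨x, -, hy⟩ := Finset.mem_biUnion.1 hy
    obtain ⟨n, -, rfl⟩ := Finset.mem_image.1 hy
    exact ⟨n, h.mem n x⟩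
  have hspan : Submodule.span R (T : Set E) = Submodule.span R S := by
    refine le_antisymm (Submodule.span_le.2 fun y hy => ?_) (Submodule.span_le.2 fun x hx => ?_)
    · obtain ⟨x, hx, hy⟩ := Finset.mem_biUnion.1 hy
      obtain ⟨n, -, rfl⟩ := Finset.mem_image.1 hy
      exact hKπ n x (Submodule.subset_span hx)
    · rw [SetLike.mem_coe, ← hs x _ subset_rfl]
      exact sum_mem fun n hn => Submodule.subset_span
        (Finset.mem_biUnion.2 ⟨x, hx, Finset.mem_image_of_mem _ hn⟩)
  obtain ⟨b, g, hg, hgT, hmin⟩ := Submodule.exists_minimal_generators (R := R) _ T hT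
  choose a ha using hg
  have hgr : IsGradedMap (freeGrading 𝒜 a) ℰ (Fintype.linearCombination R g) := by
    intro n x hx
    rw [Fintype.linearCombination_apply]
    refine sum_mem fun j _ => ?_
    rcases le_or_gt (a j) n with hj | hj
    · have h1 := h.smul_mem _ _ _ _ ((hx j).1 hj) (ha j)
      rwa [show ((n - a j).toNat : ℤ) + a j = n by omega] at h1
    · rw [(hx j).2 hj, zero_smul]
      exact zero_mem _
  have hker : ∀ n, ∀ x ∈ LinearMap.ker (Fintype.linearCombination R g),
      freeGradingProjection 𝒜 a n x ∈ LinearMap.ker (Fintype.linearCombination R g) := by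
    intro n x hx
    rw [LinearMap.mem_ker, (isGradingProjection_free a).map_comm h hgr, LinearMap.mem_ker.1 hx,
      map_zero]
  refine ⟨b, a, Fintype.linearCombination R g, ?_, hgr, fun x hx => ?_, hker⟩
  · rw [Fintype.range_linearCombination, hgT, hspan]
  · refine mem_smul_top_of_forall_mem fun j => ?_
    -- The component of degree `a j` of a relation is again a relation, with `j`-th coefficient the
    -- degree-zero part of `x j`. This is a scalar and not a unit, hence zero, so `x j` is in the
    -- irrelevant ideal.
    have h1 := hmin _ (hker (a j) x hx) j
    rw [freeGradingProjection_apply_of_le le_rfl, sub_self, Int.toNat_zero] at h1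
    obtain ⟨c, hc⟩ := hA.degree_zero _ (DirectSum.decompose 𝒜 (x j) 0).2
    rw [GradedRing.proj_apply, ← hc] at h1
    change x j ∈ HomogeneousIdeal.irrelevant 𝒜
    rw [HomogeneousIdeal.mem_irrelevant_iff, GradedRing.proj_apply, ← hc]
    rcases eq_or_ne c 0 with rfl | hc0
    · exact map_zero _
    · exact absurd ((isUnit_iff_ne_zero.2 hc0).map _) h1

/-- Minimal graded free resolutions exist over standard graded algebras. -/
theorem MinimalFreeResolution.exists_isGraded (hA : IsStandardGraded 𝒜) {M : Type*}
    [AddCommGroup M] [Module R M] [Module.Finite R M] {ℳ : ℤ → AddSubgroup M}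
    (hM : IsGradedModule 𝒜 ℳ) :
    ∃ F : MinimalFreeResolution (HomogeneousIdeal.irrelevant 𝒜).toIdeal M, F.IsGraded 𝒜 ℳ := by
  have := hA.isNoetherianRing
  obtain ⟨π, hπ⟩ := hM.exists_isGradingProjection
  obtain ⟨F, a, h1, h2⟩ := exists_of_step (m := (HomogeneousIdeal.irrelevant 𝒜).toIdeal) (M := M)
    (D := fun b => Fin b → ℤ)
    (fun _ a K => K ≤ (HomogeneousIdeal.irrelevant 𝒜).toIdeal • ⊤ ∧
      ∀ n, ∀ x ∈ K, freeGradingProjection 𝒜 a n x ∈ K)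
    (fun a a' δ => IsGradedMap (freeGrading 𝒜 a') (freeGrading 𝒜 a) δ)
    (fun a ε => IsGradedMap (freeGrading 𝒜 a) ℳ ε)
    (fun _ _ _ h => h.1)
    (fun b a K h => (isGradingProjection_free a).exists_cover hA (IsNoetherian.noetherian K) h.2)
    (hπ.exists_cover hA Module.Finite.fg_top (fun _ _ _ => trivial))
  exact ⟨F, a, h1, h2⟩

theorem MinimalFreeResolution.lind_eq {R M : Type*} [CommRing R] [IsLocalRing R] [AddCommGroup M]
    [Module R M] (F : MinimalFreeResolution (IsLocalRing.maximalIdeal R) M) :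
    lind R M = F.linearityDefect :=
  le_antisymm (iSup_le fun G => (G.linearityDefect_eq F).le) (le_iSup _ F)

/-- Independence of the resolution needs no homogeneous comparison maps, so the ungraded statement
suffices. -/
theorem MinimalFreeResolution.IsGraded.gradedLind_eq {M : Type*} [AddCommGroup M] [Module R M]
    {ℳ : ℤ → AddSubgroup M}
    {F : MinimalFreeResolution (HomogeneousIdeal.irrelevant 𝒜).toIdeal M} (hF : F.IsGraded 𝒜 ℳ) :
    gradedLind 𝒜 ℳ = F.linearityDefect :=
  le_antisymm (iSup₂_le fun G _ => (G.linearityDefect_eq F).le)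
    (le_iSup₂ (f := fun (G : MinimalFreeResolution (HomogeneousIdeal.irrelevant 𝒜).toIdeal M)
      (_ : G.IsGraded 𝒜 ℳ) => G.linearityDefect) F hF)

end Graded

end

/-- The first part is the local case, the second part the standard graded case. Linearity defects
are nonnegative, so the truncated subtraction of `ℕ∞` is harmless in `max 0 (lind R N - 1)`, and
`lind R N - 1 ≤ lind R M` is written as `lind R N ≤ lind R M + 1`. -/
theorem theorem3p5 :
    (∀ (R : Type*) [CommRing R] [IsLocalRing R] [IsNoetherianRing R]
      (M P N : Type*) [AddCommGroup M] [Module R M] [Module.Finite R M] [Nontrivial M]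
      [AddCommGroup P] [Module R P] [Module.Finite R P] [Nontrivial P]
      [AddCommGroup N] [Module R N] [Module.Finite R N] [Nontrivial N]
      (φ : M →ₗ[R] P) (lam : P →ₗ[R] N),
      Function.Injective φ → Function.Exact φ lam → Function.Surjective lam →
      IsKoszulModule R P →
      LinearMap.range φ ≤ IsLocalRing.maximalIdeal R • (⊤ : Submodule R P) →
      (lind R N ≤ lind R M + 1 ∧ lind R M ≤ max 0 (lind R N - 1)) ∧
      (1 ≤ lind R M → lind R N = lind R M + 1) ∧
      (lind R M = 0 → lind R N ≤ 1) ∧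
      (lind R N = 0 ↔
        IsKoszulModule R M ∧ ∀ s : ℕ,
          LinearMap.range φ ⊓ (IsLocalRing.maximalIdeal R ^ (s + 1) • (⊤ : Submodule R P)) =
            (IsLocalRing.maximalIdeal R ^ s • (⊤ : Submodule R M)).map φ)) ∧
    (∀ (k R : Type*) [Field k] [CommRing R] [Algebra k R]
      (𝒜 : ℕ → Submodule k R) [GradedAlgebra 𝒜],
      IsStandardGraded 𝒜 →
      ∀ (M P N : Type*) [AddCommGroup M] [Module R M] [Module.Finite R M] [Nontrivial M]
      [AddCommGroup P] [Module R P] [Module.Finite R P] [Nontrivial P]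
      [AddCommGroup N] [Module R N] [Module.Finite R N] [Nontrivial N]
      (gM : ℤ → AddSubgroup M) (gP : ℤ → AddSubgroup P) (gN : ℤ → AddSubgroup N)
      (φ : M →ₗ[R] P) (lam : P →ₗ[R] N),
      IsGradedModule 𝒜 gM → IsGradedModule 𝒜 gP → IsGradedModule 𝒜 gN →
      IsGradedMap gM gP φ → IsGradedMap gP gN lam →
      Function.Injective φ → Function.Exact φ lam → Function.Surjective lam →
      IsGradedKoszulModule 𝒜 gP →
      LinearMap.range φ ≤ (HomogeneousIdeal.irrelevant 𝒜).toIdeal • (⊤ : Submodule R P) →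
      (gradedLind 𝒜 gN ≤ gradedLind 𝒜 gM + 1 ∧
        gradedLind 𝒜 gM ≤ max 0 (gradedLind 𝒜 gN - 1)) ∧
      (1 ≤ gradedLind 𝒜 gM → gradedLind 𝒜 gN = gradedLind 𝒜 gM + 1) ∧
      (gradedLind 𝒜 gM = 0 → gradedLind 𝒜 gN ≤ 1) ∧
      (gradedLind 𝒜 gN = 0 ↔
        IsGradedKoszulModule 𝒜 gM ∧ ∀ s : ℕ,
          LinearMap.range φ ⊓
              ((HomogeneousIdeal.irrelevant 𝒜).toIdeal ^ (s + 1) • (⊤ : Submodule R P)) =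
            ((HomogeneousIdeal.irrelevant 𝒜).toIdeal ^ s • (⊤ : Submodule R M)).map φ)) := by
  refine ⟨?_, ?_⟩
  · intro R _ _ _ M P N _ _ _ _ _ _ _ _ _ _ _ _ φ lam hφ hex hlam hP hφm
    obtain ⟨F⟩ := MinimalFreeResolution.exists_of_isLocalRing R M
    obtain ⟨G⟩ := MinimalFreeResolution.exists_of_isLocalRing R P
    obtain ⟨H⟩ := MinimalFreeResolution.exists_of_isLocalRing R N
    rw [IsKoszulModule, G.lind_eq] at hP
    rw [IsKoszulModule, F.lind_eq, H.lind_eq]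
    exact F.linearityDefect_of_exact G H hφ hex hlam hP hφm
  · intro k R _ _ _ 𝒜 _ hA M P N _ _ _ _ _ _ _ _ _ _ _ _ gM gP gN φ lam hM hP hN _ _ hφ hex hlam
      hK hφm
    obtain ⟨F, hF⟩ := MinimalFreeResolution.exists_isGraded hA hM
    obtain ⟨G, hG⟩ := MinimalFreeResolution.exists_isGraded hA hP
    obtain ⟨H, hH⟩ := MinimalFreeResolution.exists_isGraded hA hN
    rw [IsGradedKoszulModule, hG.gradedLind_eq] at hK
    rw [IsGradedKoszulModule, hF.gradedLind_eq, hH.gradedLind_eq]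
    exact F.linearityDefect_of_exact G H hφ hex hlam hK hφm
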